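/- Let $K$ be a field, $S=K[x_1,\dots,x_n]$, and let $I\subseteq S$ be a matroidal ideal, that is, a nonzero squarefree monomial ideal such that the exponent vectors of its minimal monomial generators are the bases of a discrete polymatroid (equivalently, the supports of the minimal monomial generators of $I$ are the bases of a matroid on $\{1,\dots,n\}$). For a non-empty set $F\subseteq\{1,\dots,n\}$ put $P_F=(x_i : i\in F)$. For $k\ge 1$ let $$I^{(k)}=\bigcap_{P\in\mathrm{Ass}(S/I)}\bigl(I^kS_P\cap S\bigr)$$ be the $k$-th symbolic power of $I$. A squarefree monomial ideal $J$ is called König if $J=S$ or if $J$ contains a regular sequence of monomials of length $\mathrm{height}(J)$; the ideal $I$ is called packed if every ideal obtained from $I$ by setting a (possibly empty) subset of the variables equal to $0$ and a disjoint (possibly empty) subset of the variables equal to $1$ is König. Then the following conditions are equivalent: (a) $I=P_{F_1}\cdots P_{F_t}$ for some $t\ge 0$ and some non-empty, pairwise disjoint subsets $F_1,\dots,F_t$ of $\{1,\dots,n\}$ (for $t=0$ the product is $S$); (b) $I^{(k)}=I^k$ for all $k\ge 1$; (c) $I$ is packed. In particular, the Conforti–Cornuéjols conjecture ($I^{(k)}=I^k$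 for all $k\ge1$ if and only if $I$ is packed) holds for matroidal ideals. -/

import Mathlib

open MvPolynomial

/-- A monomial ideal: an ideal of `K[x_1, …, x_n]` generated by monomials. -/
def IsMonomialIdeal {K : Type*} [Field K] {n : ℕ} (I : Ideal (MvPolynomial (Fin n) K)) : Prop :=
  ∃ s : Set (Fin n →₀ ℕ), I = Ideal.span ((fun u => monomial u (1 : K)) '' s)

/-- The exponent vectors of the minimal monomial generators of a monomial ideal: the monomials of
the ideal that are minimal with respect to divisibility. -/
def minimalGenerators {K : Type*} [Field K] {n : ℕ} (I : Ideal (MvPolynomial (Fin n) K)) :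
    Set (Fin n →₀ ℕ) :=
  {u | Minimal (fun v => monomial v (1 : K) ∈ I) u}

/-- A discrete polymatroid on the ground set `Fin n`: a nonempty finite set of vectors with
nonnegative integer entries, closed under passing to smaller vectors, and with the augmentation
property. Here `Finsupp.degree u` is the sum of the entries of `u`. -/
structure IsDiscretePolymatroid {n : ℕ} (P : Set (Fin n →₀ ℕ)) : Prop where
  nonempty : P.Nonempty
  finite : P.Finite
  mem_of_le : ∀ u ∈ P, ∀ v, v ≤ u → v ∈ P
  augment : ∀ u ∈ P, ∀ v ∈ P, Finsupp.degree u < Finsupp.degree v →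
    ∃ i, u i < v i ∧ u + Finsupp.single i 1 ∈ P

/-- The bases of a discrete polymatroid: its maximal vectors. -/
def polymatroidBases {n : ℕ} (P : Set (Fin n →₀ ℕ)) : Set (Fin n →₀ ℕ) :=
  {u | Maximal (fun v => v ∈ P) u}

/-- A polymatroidal ideal: a monomial ideal such that the exponent vectors of its minimal monomial
generators are the bases of a discrete polymatroid. (In particular it is nonzero.) -/
def IsPolymatroidalIdeal {K : Type*} [Field K] {n : ℕ}
    (I : Ideal (MvPolynomial (Fin n) K)) : Prop :=
  IsMonomialIdeal I ∧
    ∃ P : Set (Fin n →₀ ℕ), IsDiscretePolymatroid P ∧ minimalGenerators I = polymatroidBases P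

/-- A monomial ideal is squarefree if its minimal monomial generators are squarefree. -/
def IsSquarefreeMonomialIdeal {K : Type*} [Field K] {n : ℕ}
    (I : Ideal (MvPolynomial (Fin n) K)) : Prop :=
  IsMonomialIdeal I ∧ ∀ u ∈ minimalGenerators I, ∀ i, u i ≤ 1

/-- A matroidal ideal is a squarefree polymatroidal ideal. -/
def IsMatroidalIdeal {K : Type*} [Field K] {n : ℕ} (I : Ideal (MvPolynomial (Fin n) K)) : Prop :=
  IsPolymatroidalIdeal I ∧ IsSquarefreeMonomialIdeal I

/-- The monomial prime ideal `P_F = (x_i : i ∈ F)`. -/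
noncomputable def monomialPrime (K : Type*) [Field K] {n : ℕ} (F : Finset (Fin n)) :
    Ideal (MvPolynomial (Fin n) K) :=
  Ideal.span (X '' (F : Set (Fin n)))

/-- The `k`-th symbolic power of `I`: the intersection of the ideals `I ^ k R_P ∩ R`, where `P`
runs over the associated primes of `R ⧸ I`. -/
noncomputable def symbolicPower {R : Type*} [CommRing R] (I : Ideal R) (k : ℕ) : Ideal R :=
  ⨅ P : associatedPrimes R (R ⧸ I),
    ((I ^ k).map (algebraMap R (Localization.AtPrime P.1))).comap
      (algebraMap R (Localization.AtPrime P.1))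

/-- A monomial ideal `I` is König if it contains a regular sequence of monomials whose length is
the height of `I`. The unit ideal, whose height is infinite, is König by convention. -/
def IsKonig {K : Type*} [Field K] {n : ℕ} (I : Ideal (MvPolynomial (Fin n) K)) : Prop :=
  I = ⊤ ∨ ∃ rs : List (MvPolynomial (Fin n) K),
    (∀ f ∈ rs, f ∈ I ∧ ∃ u : Fin n →₀ ℕ, f = monomial u 1) ∧
    RingTheory.Sequence.IsRegular (MvPolynomial (Fin n) K) rs ∧
    (rs.length : ℕ∞) = I.height

/-- The ideal obtained from `I` by setting the variables indexed by `A` equal to `0` and those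
indexed by `B` equal to `1`. It is regarded as an ideal of the same polynomial ring, namely the
ideal generated by all the polynomials obtained from elements of `I` by the substitution. -/
noncomputable def substZeroOne {K : Type*} [Field K] {n : ℕ} (I : Ideal (MvPolynomial (Fin n) K))
    (A B : Finset (Fin n)) : Ideal (MvPolynomial (Fin n) K) :=
  I.map (aeval (R := K) fun i : Fin n =>
    if i ∈ A then (0 : MvPolynomial (Fin n) K) else if i ∈ B then 1 else X i)

/-- A squarefree monomial ideal is packed if all the ideals obtained from it by setting a (possibly
empty) subset of the variables equal to `0` and a disjoint (possibly empty) subset of the variables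
equal to `1` are König. -/
def IsPacked {K : Type*} [Field K] {n : ℕ} (I : Ideal (MvPolynomial (Fin n) K)) : Prop :=
  ∀ A B : Finset (Fin n), Disjoint A B → IsKonig (substZeroOne I A B)

/-! Fix a base `B` of the matroid. If every nonloop is parallel to an element of `B`, the bases are
exactly the transversals of the parallel classes of `B`, and `I` is the product of the primes of
these classes (`exists_eq_prod_monomialPrime`). Otherwise some nonloop `c` has a fundamental circuit
with two further elements `x`, `y`, and for `W = B \ {x, y}` all three sets formed by `W` and two of
`x`, `y`, `c` are bases (`IsTriangle`).

A triangle refutes (b): the monomial `x y c (∏ W)²` lies in the second symbolic power, but its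
degree is one less than that of the generators of `I²`. It also refutes (c): with `W` set to 1 and
the variables outside `W ∪ {x, y, c}` set to 0, the ideal has height at least 2, but any two of its
monomials share a variable.

Conversely, let `I` be a product of primes on disjoint blocks. Each block prime is associated to
`S/I` and has primary powers, so an element of the symbolic power has degree at least `k` in every
block, hence lies in `I^k`. Setting variables to 0 or 1 preserves the product form, and such
products are König: transversal monomials on disjoint supports, as many as the smallest block has
variables, attain the height. -/

/-! ### Monomial primes: powers, primality and height -/

section MonomialPrime

variable {K : Type*} [Field K] {n : ℕ}

/-- The substitution `x_i ↦ T x_i` for `i ∈ F`, `x_i ↦ x_i` for `i ∉ F`, with values in `S[T]`. -/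
noncomputable def gradingHom (K : Type*) [Field K] {n : ℕ} (F : Finset (Fin n)) :
    MvPolynomial (Fin n) K →ₐ[K] Polynomial (MvPolynomial (Fin n) K) :=
  aeval fun i => Polynomial.C (X i) * Polynomial.X ^ (if i ∈ F then 1 else 0)

lemma gradingHom_monomial (F : Finset (Fin n)) (u : Fin n →₀ ℕ) (a : K) :
    gradingHom K F (monomial u a) =
      Polynomial.C (monomial u a) * Polynomial.X ^ (∑ i ∈ F, u i) := by
  have h1 : ∀ i, (Polynomial.X ^ (if i ∈ F then 1 else 0) :
      Polynomial (MvPolynomial (Fin n) K)) ^ u i = Polynomial.X ^ (if i ∈ F then u i else 0) := by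
    intro i; split_ifs <;> simp
  rw [gradingHom, aeval_monomial, Finsupp.prod_fintype _ _ (by simp)]
  simp_rw [mul_pow, h1, Finset.prod_mul_distrib, Finset.prod_pow_eq_pow_sum]
  rw [← Finset.sum_filter, Finset.filter_mem_eq_inter, Finset.univ_inter, ← mul_assoc]
  congr 1
  rw [monomial_eq, Finsupp.prod_fintype _ _ (by simp)]
  simp [IsScalarTower.algebraMap_apply K (MvPolynomial (Fin n) K), MvPolynomial.algebraMap_eq]

/-- The exponent of `T` records the degree in the variables of `F`, so taking a coefficient extracts
a homogeneous component for this grading. -/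
lemma coeff_coeff_gradingHom (F : Finset (Fin n)) (g : MvPolynomial (Fin n) K) (j : ℕ)
    (u : Fin n →₀ ℕ) :
    coeff u ((gradingHom K F g).coeff j) = if ∑ i ∈ F, u i = j then coeff u g else 0 := by
  induction g using MvPolynomial.induction_on' with
  | monomial v a =>
    rw [gradingHom_monomial, Polynomial.coeff_C_mul_X_pow]
    by_cases h : v = u
    · subst h
      by_cases h2 : ∑ i ∈ F, v i = j
      · simp [h2]
      · rw [if_neg (Ne.symm h2), if_neg h2]; simp
    · split_ifs <;> simp [h]
  | add p q hp hq =>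
    rw [map_add, Polynomial.coeff_add, coeff_add, hp, hq]
    split_ifs <;> simp

lemma X_pow_dvd_gradingHom_iff (F : Finset (Fin n)) (g : MvPolynomial (Fin n) K) (k : ℕ) :
    Polynomial.X ^ k ∣ gradingHom K F g ↔ ∀ u ∈ g.support, k ≤ ∑ i ∈ F, u i := by
  rw [Polynomial.X_pow_dvd_iff]
  constructor
  · intro h u hu
    by_contra! hlt
    have := coeff_coeff_gradingHom F g (∑ i ∈ F, u i) u
    rw [h _ hlt, if_pos rfl] at this
    simp_all
  · intro h j hj
    ext u
    rw [coeff_coeff_gradingHom]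
    split_ifs with hu
    · by_contra hne
      have := h u (by simpa [mem_support_iff] using hne)
      omega
    · simp

lemma X_mem_monomialPrime {F : Finset (Fin n)} {i : Fin n} (h : i ∈ F) :
    (X i : MvPolynomial (Fin n) K) ∈ monomialPrime K F :=
  Ideal.subset_span ⟨i, h, rfl⟩

/-- A monomial of degree at least `k` in each of the disjoint blocks `F i` lies in
the product of the `k`-th powers of the primes `P_{F i}`. -/
lemma monomial_mem_prod_monomialPrime_pow {ι : Type*} (s : Finset ι) (F : ι → Finset (Fin n))
    (hF : (s : Set ι).PairwiseDisjoint F) (u : Fin n →₀ ℕ) (a : K) (k : ℕ)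
    (h : ∀ i ∈ s, k ≤ ∑ j ∈ F i, u j) :
    monomial u a ∈ ∏ i ∈ s, monomialPrime K (F i) ^ k := by
  classical
  rw [monomial_eq, Finsupp.prod_fintype _ _ (by simp)]
  have h1 : ∏ i ∈ s, ∏ j ∈ F i, (X j : MvPolynomial (Fin n) K) ^ u j ∈
      ∏ i ∈ s, monomialPrime K (F i) ^ k := by
    refine Ideal.prod_mem_prod fun i hi => Ideal.pow_le_pow_right (h i hi) ?_
    rw [← Finset.prod_pow_eq_pow_sum]
    exact Ideal.prod_mem_prod fun j hj => Ideal.pow_mem_pow (X_mem_monomialPrime hj) _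
  refine Ideal.mul_mem_left _ _ (Ideal.mem_of_dvd _ ?_ h1)
  rw [← Finset.prod_biUnion hF]
  exact Finset.prod_dvd_prod_of_subset _ _ _ (Finset.subset_univ _)

lemma mem_prod_monomialPrime_pow {ι : Type*} (s : Finset ι) (F : ι → Finset (Fin n))
    (hF : (s : Set ι).PairwiseDisjoint F) (g : MvPolynomial (Fin n) K) (k : ℕ)
    (h : ∀ u ∈ g.support, ∀ i ∈ s, k ≤ ∑ j ∈ F i, u j) :
    g ∈ ∏ i ∈ s, monomialPrime K (F i) ^ k := by
  rw [g.as_sum]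
  exact Ideal.sum_mem _ fun u hu => monomial_mem_prod_monomialPrime_pow s F hF u _ k (h u hu)

/-- Since `T` is a prime element of `S[T]`, this description yields both that `P_F` is prime and
that its powers are primary. -/
lemma mem_monomialPrime_pow_iff_dvd {F : Finset (Fin n)} {g : MvPolynomial (Fin n) K} {k : ℕ} :
    g ∈ monomialPrime K F ^ k ↔ Polynomial.X ^ k ∣ gradingHom K F g := by
  constructor
  · intro h
    have h1 : monomialPrime K F ≤ (Ideal.span {Polynomial.X}).comap (gradingHom K F) := by
      rw [monomialPrime, Ideal.span_le]
      rintro _ ⟨i, hi, rfl⟩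
      have : i ∈ F := hi
      simp [gradingHom, this, Ideal.mem_span_singleton]
    have h2 := Ideal.le_comap_pow (gradingHom K F) k (Ideal.pow_right_mono h1 k h)
    rwa [Ideal.span_singleton_pow, Ideal.mem_comap, Ideal.mem_span_singleton] at h2
  · intro h
    rw [X_pow_dvd_gradingHom_iff] at h
    simpa using mem_prod_monomialPrime_pow {()} (fun _ => F) (by simp) g k (by simpa using h)

lemma mem_monomialPrime_pow_iff {F : Finset (Fin n)} {g : MvPolynomial (Fin n) K} {k : ℕ} :
    g ∈ monomialPrime K F ^ k ↔ ∀ u ∈ g.support, k ≤ ∑ i ∈ F, u i := by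
  rw [mem_monomialPrime_pow_iff_dvd, X_pow_dvd_gradingHom_iff]

lemma monomial_mem_monomialPrime_pow_iff {F : Finset (Fin n)} {u : Fin n →₀ ℕ} {k : ℕ} :
    monomial u (1 : K) ∈ monomialPrime K F ^ k ↔ k ≤ ∑ i ∈ F, u i := by
  classical
  rw [mem_monomialPrime_pow_iff, support_monomial, if_neg one_ne_zero]
  simp

lemma mem_monomialPrime_iff_dvd {F : Finset (Fin n)} {g : MvPolynomial (Fin n) K} :
    g ∈ monomialPrime K F ↔ Polynomial.X ∣ gradingHom K F g := by
  simpa using mem_monomialPrime_pow_iff_dvd (F := F) (g := g) (k := 1)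

instance monomialPrime_isPrime (F : Finset (Fin n)) : (monomialPrime K F).IsPrime := by
  have h : monomialPrime K F = (Ideal.span {Polynomial.X}).comap (gradingHom K F) := by
    ext g
    rw [mem_monomialPrime_iff_dvd, Ideal.mem_comap, Ideal.mem_span_singleton]
  have : (Ideal.span {(Polynomial.X : Polynomial (MvPolynomial (Fin n) K))}).IsPrime :=
    (Ideal.span_singleton_prime Polynomial.X_ne_zero).2 Polynomial.prime_X
  rw [h]
  infer_instance

/-- The powers of a monomial prime ideal are primary. -/
lemma mem_monomialPrime_pow_of_mul_mem {F : Finset (Fin n)} {s g : MvPolynomial (Fin n) K} {k : ℕ}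
    (hs : s ∉ monomialPrime K F) (h : s * g ∈ monomialPrime K F ^ k) :
    g ∈ monomialPrime K F ^ k := by
  rw [mem_monomialPrime_iff_dvd] at hs
  rw [mem_monomialPrime_pow_iff_dvd, map_mul] at h
  rw [mem_monomialPrime_pow_iff_dvd]
  exact Polynomial.prime_X.pow_dvd_of_dvd_mul_left _ hs h

lemma X_mem_monomialPrime_iff {F : Finset (Fin n)} {i : Fin n} :
    (X i : MvPolynomial (Fin n) K) ∈ monomialPrime K F ↔ i ∈ F := by
  have := monomial_mem_monomialPrime_pow_iff (K := K) (F := F) (u := Finsupp.single i 1) (k := 1)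
  rw [pow_one] at this
  rw [X, this]
  simp [Finsupp.single_apply, Finset.sum_ite_eq, Nat.one_le_iff_ne_zero]

/-- Adjoining the variables one at a time gives a strictly increasing chain of monomial primes, and
height is monotone. -/
lemma card_le_height_of_X_mem (F : Finset (Fin n)) (P : Ideal (MvPolynomial (Fin n) K))
    (h : ∀ i ∈ F, X i ∈ P) : (F.card : ℕ∞) ≤ P.height := by
  suffices H : (F.card : ℕ∞) ≤ (monomialPrime K F).height by
    refine H.trans (Ideal.height_mono ?_)
    rw [monomialPrime, Ideal.span_le]
    rintro _ ⟨i, hi, rfl⟩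
    exact h i hi
  clear h P
  induction F using Finset.induction_on with
  | empty => simp
  | insert a F ha ih =>
    rw [Finset.card_insert_of_notMem ha, Nat.cast_add, Nat.cast_one]
    refine (add_le_add_left ih 1).trans (Ideal.height_add_one_le_of_lt_of_isPrime ?_)
    refine lt_of_le_of_ne (Ideal.span_mono (Set.image_mono (by simp))) fun he => ha ?_
    rw [← X_mem_monomialPrime_iff (K := K), he, X_mem_monomialPrime_iff]
    simp

lemma height_monomialPrime_le (F : Finset (Fin n)) :
    (monomialPrime K F).height ≤ F.card := by
  refine (Ideal.height_le_spanFinrank _ (monomialPrime_isPrime F).ne_top).trans ?_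
  rw [Nat.cast_le]
  refine (Submodule.spanFinrank_span_le_ncard_of_finite (F.finite_toSet.image _)).trans ?_
  exact (Set.ncard_image_le F.finite_toSet).trans (by simp)

end MonomialPrime

/-! ### Parallel classes and bases of a matroid -/

section Matroid

variable {α : Type*}

/-- The nonloops parallel to `b`. -/
def parallelClass (M : Matroid α) (b : α) : Set α :=
  {c | M.IsNonloop c ∧ c ∈ M.closure {b}}

lemma eq_of_mem_parallelClass_of_indep {M : Matroid α} {I : Set α} (hI : M.Indep I) {b c d : α}
    (hc : c ∈ parallelClass M b) (hd : d ∈ parallelClass M b) (hcI : c ∈ I) (hdI : d ∈ I) :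
    c = d := by
  have h := (hc.1.closure_eq_of_mem_closure hc.2).trans (hd.1.closure_eq_of_mem_closure hd.2).symm
  rw [hc.1.closure_eq_closure_iff_eq_or_dep hd.1] at h
  refine h.resolve_right fun h => h (hI.subset ?_)
  rintro x (rfl | rfl) <;> assumption

lemma mem_parallelClass_symm {M : Matroid α} {b c : α} (hc : c ∈ parallelClass M b) :
    b ∈ parallelClass M c :=
  ⟨hc.1.isNonloop_of_mem_closure hc.2, hc.1.mem_closure_singleton hc.2⟩

lemma eq_of_mem_parallelClass {M : Matroid α} {B : Set α} (hB : M.Indep B) {b b' c : α}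
    (hb : b ∈ B) (hb' : b' ∈ B) (h : c ∈ parallelClass M b) (h' : c ∈ parallelClass M b') :
    b = b' :=
  eq_of_mem_parallelClass_of_indep hB (mem_parallelClass_symm h) (mem_parallelClass_symm h') hb hb'

/-- Either all nonloops are parallel to elements of the base `B`, or some fundamental circuit
has at least three elements. -/
lemma parallel_or_exists_exchange {M : Matroid α} {B : Set α} (hB : M.IsBase B) :
    (∀ c, M.IsNonloop c → ∃ b ∈ B, c ∈ M.closure {b}) ∨
    ∃ c ∉ B, ∃ x ∈ B, ∃ y ∈ B, x ≠ y ∧ M.IsBase (insert c (B \ {x})) ∧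
      M.IsBase (insert c (B \ {y})) := by
  rw [or_iff_not_imp_left]
  intro h
  push Not at h
  obtain ⟨c, hc, h⟩ := h
  have hcB : c ∉ B := fun hcB => h c hcB (M.mem_closure_self c hc.mem_ground)
  have hC := hB.fundCircuit_isCircuit hc.mem_ground hcB
  have hcC := M.mem_fundCircuit c B
  have hsub : M.fundCircuit c B \ {c} ⊆ B := by
    rw [M.fundCircuit_sdiff_eq_inter hcB]; exact Set.inter_subset_right
  have hcl := hC.mem_closure_sdiff_singleton_of_mem hcC
  -- If the circuit were `{c}`, then `c` would be a loop; if it were `{c, b}`, then `c` would be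
  -- parallel to `b ∈ B`.
  have hnt : (M.fundCircuit c B \ {c}).Nontrivial := by
    rw [← Set.not_subsingleton_iff]
    intro hss
    rcases hss.eq_empty_or_singleton with h0 | ⟨b, hb⟩
    · rw [h0] at hcl
      exact hc.not_isLoop hcl
    · rw [hb] at hcl
      exact h b (hsub (by rw [hb]; rfl)) hcl
  obtain ⟨x, hx, y, hy, hxy⟩ := hnt
  have key : ∀ z ∈ M.fundCircuit c B \ {c}, M.IsBase (insert c (B \ {z})) := by
    intro z hz
    refine hB.exchange_isBase_of_indep hcB ?_
    have h1 := (hB.indep.mem_fundCircuit_iff (by rw [hB.closure_eq]; exact hc.mem_ground)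
      hcB).1 hz.1
    rwa [← Set.insert_sdiff_singleton_comm (Ne.symm hz.2)] at h1
  exact ⟨c, hcB, x, hsub hx, y, hsub hy, hxy, key x hx, key y hy⟩

/-- The transversals of the parallel classes of the elements of a base are bases. -/
lemma isBase_image_of_mem_parallelClass [Finite α] {M : Matroid α} {B : Set α} (hB : M.IsBase B)
    {t : α → α} (ht : ∀ b ∈ B, t b ∈ parallelClass M b) : M.IsBase (t '' B) := by
  have hg : t '' B ⊆ M.E := by
    rintro _ ⟨b, hb, rfl⟩
    exact (ht b hb).1.mem_ground
  have hsp : M.Spanning (t '' B) := by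
    rw [Matroid.spanning_iff_ground_subset_closure hg, ← hB.closure_eq]
    refine M.closure_subset_closure_of_subset_closure fun b hb => ?_
    exact M.closure_subset_closure (by simpa using ⟨b, hb, rfl⟩) (mem_parallelClass_symm (ht b hb)).2
  obtain ⟨B', hB', hsub⟩ := hsp.exists_isBase_subset
  -- A spanning set with at most as many elements as a base is a base.
  have : B' = t '' B := Set.eq_of_subset_of_ncard_le hsub
    ((Set.ncard_image_le B.toFinite).trans (hB.ncard_eq_ncard_of_isBase hB').le) (Set.toFinite _)
  rwa [← this]

/-- If all nonloops are parallel to elements of the base `B`, every base is a transversal of the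
parallel classes of the elements of `B`. -/
lemma exists_bijOn_parallelClass [Finite α] {M : Matroid α} {B B' : Set α} (hB : M.IsBase B)
    (hB' : M.IsBase B') (h : ∀ c, M.IsNonloop c → ∃ b ∈ B, c ∈ M.closure {b}) :
    ∃ t : α → α, Set.BijOn t B' B ∧ ∀ c ∈ B', c ∈ parallelClass M (t c) := by
  have h1 : ∀ c, ∃ b, c ∈ B' → b ∈ B ∧ c ∈ parallelClass M b := by
    intro c
    by_cases hc : c ∈ B'
    · have hnl := hB'.indep.isNonloop_of_mem hc
      obtain ⟨b, hb, hcb⟩ := h c hnl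
      exact ⟨b, fun _ => ⟨hb, hnl, hcb⟩⟩
    · exact ⟨c, fun h => (hc h).elim⟩
  choose t ht using h1
  have hinj : Set.InjOn t B' := by
    intro c hc d hd hcd
    exact eq_of_mem_parallelClass_of_indep hB'.indep (ht c hc).2 (hcd ▸ (ht d hd).2) hc hd
  have hmaps : Set.MapsTo t B' B := fun c hc => (ht c hc).1
  refine ⟨t, ⟨hmaps, hinj, ?_⟩, fun c hc => (ht c hc).2⟩
  have : t '' B' = B := Set.eq_of_subset_of_ncard_le hmaps.image_subset
    (by rw [hinj.ncard_image]; exact (hB.ncard_eq_ncard_of_isBase hB').le) B.toFinite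
  exact this.superset

end Matroid

/-! ### Regular sequences of monomials and the König property -/

section Konig

variable {K : Type*} [Field K] {n : ℕ}

lemma ofList_monomial_smul_top (L : List (Fin n →₀ ℕ)) :
    (Ideal.ofList (L.map fun u => monomial u (1 : K)) • ⊤ : Submodule (MvPolynomial (Fin n) K)
      (MvPolynomial (Fin n) K)) =
      Ideal.span ((fun u => monomial u (1 : K)) '' {u | u ∈ L}) := by
  rw [smul_eq_mul, Ideal.mul_top, Ideal.ofList]
  congr 1
  ext f
  simp

/-- Monomials different from `1` with pairwise disjoint supports form a regular sequence. -/
lemma isRegular_monomial (L : List (Fin n →₀ ℕ))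
    (hL : L.Pairwise fun u v => ∀ i, u i = 0 ∨ v i = 0) (h0 : ∀ u ∈ L, u ≠ 0) :
    RingTheory.Sequence.IsRegular (MvPolynomial (Fin n) K)
      (L.map fun u => monomial u (1 : K)) := by
  refine ⟨⟨fun i hi => ?_⟩, ?_⟩
  · rw [← List.map_take, ofList_monomial_smul_top, isSMulRegular_quotient_iff_mem_of_smul_mem]
    intro f hf
    rw [mem_ideal_span_monomial_image] at hf ⊢
    intro u hu
    have hi' : i < L.length := by simpa using hi
    obtain ⟨v, hv, hle⟩ := hf (L[i] + u) (by
      rw [List.getElem_map, smul_eq_mul, mem_support_iff, coeff_monomial_mul, one_mul]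
      exact mem_support_iff.1 hu)
    refine ⟨v, hv, fun j => ?_⟩
    obtain ⟨l, hl, rfl⟩ := List.mem_take_iff_getElem.1 hv
    -- The earlier generator divides `L[i] + u` and shares no variable with `L[i]`, so it already
    -- divides `u`.
    rcases List.pairwise_iff_getElem.1 hL l i (by omega) hi' (by omega) j with h | h
    · simp [h]
    · have := hle j
      rwa [Finsupp.add_apply, h, zero_add] at this
  · rw [ofList_monomial_smul_top]
    intro h
    have h1 : (1 : MvPolynomial (Fin n) K) ∈
        Ideal.span ((fun u => monomial u (1 : K)) '' {u | u ∈ L}) := by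
      rw [← h]; trivial
    rw [mem_ideal_span_monomial_image] at h1
    obtain ⟨u, hu, hle⟩ := h1 0 (by simp)
    exact h0 u hu (le_antisymm hle (zero_le))

lemma monomial_sum_single {ι : Type*} (s : Finset ι) (e : ι → Fin n) :
    monomial (∑ i ∈ s, Finsupp.single (e i) 1) (1 : K) = ∏ i ∈ s, X (e i) := by
  rw [monomial_sum_one]
  rfl

/-- A product of prime ideals generated by pairwise disjoint sets of variables is König. -/
lemma isKonig_prod_monomialPrime {ι : Type*} [Fintype ι] (F : ι → Finset (Fin n))
    (hF : ∀ i j, i ≠ j → Disjoint (F i) (F j)) : IsKonig (∏ i, monomialPrime K (F i)) := by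
  rcases isEmpty_or_nonempty ι with hι | hι
  · left; simp [Ideal.one_eq_top]
  right
  obtain ⟨i₀, -, hmin⟩ := Finset.exists_min_image Finset.univ (fun i => (F i).card)
    Finset.univ_nonempty
  obtain ⟨m, hm⟩ : ∃ m, (F i₀).card = m := ⟨_, rfl⟩
  have he : ∀ i, ∃ e : Fin m → Fin n, Function.Injective e ∧ ∀ j, e j ∈ F i := by
    intro i
    have hi : m ≤ (F i).card := hm ▸ hmin i (Finset.mem_univ _)
    exact ⟨fun j => ((F i).equivFin.symm (Fin.castLE hi j)).1,
      Subtype.val_injective.comp ((Equiv.injective _).comp (Fin.castLE_injective hi)),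
      fun j => Subtype.prop _⟩
  choose e hinj hmem using he
  -- The `j`-th monomial takes the `j`-th chosen variable from each block. If some block is empty,
  -- then `m = 0` and the sequence is empty, matching the height of the zero ideal.
  let w : Fin m → Fin n →₀ ℕ := fun j => ∑ i, Finsupp.single (e i j) 1
  have hw : ∀ j z, w j z ≠ 0 → ∃ i, e i j = z := by
    intro j z h
    by_contra! hne
    refine h ?_
    simp only [w, Finsupp.finsetSum_apply]
    exact Finset.sum_eq_zero fun i _ => Finsupp.single_eq_of_ne (hne i).symm
  refine ⟨(List.ofFn w).map fun u => monomial u (1 : K), ?_, isRegular_monomial _ ?_ ?_, ?_⟩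
  · simp only [List.mem_map, List.mem_ofFn]
    rintro _ ⟨_, ⟨j, rfl⟩, rfl⟩
    refine ⟨?_, _, rfl⟩
    rw [monomial_sum_single]
    exact Ideal.prod_mem_prod fun i _ => X_mem_monomialPrime (hmem i j)
  · rw [List.pairwise_ofFn]
    intro j l hjl z
    by_contra! hne
    obtain ⟨i, hi⟩ := hw j z hne.1
    obtain ⟨i', hi'⟩ := hw l z hne.2
    by_cases h : i = i'
    · subst h
      exact hjl.ne (hinj i (hi.trans hi'.symm))
    · exact Finset.disjoint_left.1 (hF i i' h) (hi ▸ hmem i j) (hi' ▸ hmem i' l)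
  · simp only [List.mem_ofFn]
    rintro _ ⟨j, rfl⟩ h0
    have h1 : ∑ i, Finsupp.single (e i j) 1 (e i₀ j) = 0 := by
      rw [← Finsupp.finsetSum_apply]
      exact DFunLike.congr_fun h0 (e i₀ j)
    rw [Finset.sum_eq_zero_iff] at h1
    simpa using h1 i₀ (Finset.mem_univ _)
  · rw [List.length_map, List.length_ofFn]
    -- A prime over the product contains some block prime, of height at least `m`; the smallest
    -- block gives the upper bound.
    apply le_antisymm
    · rw [Ideal.height_eq_inf_minimalPrimes]
      refine le_iInf₂ fun P hP => ?_
      have := hP.isPrime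
      obtain ⟨i, -, hi⟩ := (Ideal.IsPrime.prod_le ‹P.IsPrime›).1 hP.le
      refine le_trans ?_ (card_le_height_of_X_mem (F i) P fun j hj => hi (X_mem_monomialPrime hj))
      exact Nat.cast_le.2 (hm ▸ hmin i (Finset.mem_univ _))
    · have h1 : ∏ i, monomialPrime K (F i) ≤ monomialPrime K (F i₀) :=
        Ideal.prod_le_inf.trans (Finset.inf_le (Finset.mem_univ i₀))
      exact (Ideal.height_mono h1).trans (hm ▸ height_monomialPrime_le (F i₀))

/-- An ideal lying between `(x_a x_b, x_a x_c, x_b x_c)` and the primes generated by two of the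
three variables is not König. -/
lemma not_isKonig_of_triangle {J : Ideal (MvPolynomial (Fin n) K)} {a b c : Fin n}
    (hab : a ≠ b) (hac : a ≠ c) (hbc : b ≠ c)
    (mab : X a * X b ∈ J) (mac : X a * X c ∈ J) (mbc : X b * X c ∈ J)
    (lab : J ≤ monomialPrime K {a, b}) (lac : J ≤ monomialPrime K {a, c})
    (lbc : J ≤ monomialPrime K {b, c}) : ¬ IsKonig J := by
  rintro (h | ⟨rs, hrs, hreg, hlen⟩)
  · exact (monomialPrime_isPrime {a, b}).ne_top (top_le_iff.1 (h ▸ lab))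
  have hht : (2 : ℕ∞) ≤ J.height := by
    rw [Ideal.height_eq_inf_minimalPrimes]
    refine le_iInf₂ fun P hP => ?_
    have hPp := hP.isPrime
    have key : ∀ p q : Fin n, p ≠ q → X p ∈ P → X q ∈ P → (2 : ℕ∞) ≤ P.height := by
      intro p q hpq hp hq
      have := card_le_height_of_X_mem {p, q} P (by simp [hp, hq])
      rwa [Finset.card_pair hpq] at this
    rcases hPp.mem_or_mem (hP.le mab) with h1 | h1
    · rcases hPp.mem_or_mem (hP.le mbc) with h2 | h2
      · exact key a b hab h1 h2
      · exact key a c hac h1 h2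
    · rcases hPp.mem_or_mem (hP.le mac) with h2 | h2
      · exact key a b hab h2 h1
      · exact key b c hbc h1 h2
  rw [← hlen] at hht
  have hlen2 : 2 ≤ rs.length := by exact_mod_cast hht
  match rs, hlen2 with
  | f :: g :: tl, _ =>
    obtain ⟨hfJ, u, rfl⟩ := hrs f (by simp)
    obtain ⟨hgJ, v, rfl⟩ := hrs g (by simp)
    have hpair : ∀ p q : Fin n, p ≠ q → J ≤ monomialPrime K {p, q} → ∀ w : Fin n →₀ ℕ,
        monomial w (1 : K) ∈ J → 1 ≤ w p + w q := by
      intro p q hpq hle w hw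
      have := hle hw
      rw [← pow_one (monomialPrime K _), monomial_mem_monomialPrime_pow_iff,
        Finset.sum_pair hpq] at this
      exact this
    -- Each exponent vector meets every pair from `{a, b, c}`, so it involves at least two of the
    -- three variables, and two such vectors overlap.
    obtain ⟨z, hz⟩ : ∃ z, 1 ≤ u z ∧ 1 ≤ v z := by
      have h1 := hpair a b hab lab u hfJ
      have h2 := hpair a c hac lac u hfJ
      have h3 := hpair b c hbc lbc u hfJ
      have h4 := hpair a b hab lab v hgJ
      have h5 := hpair a c hac lac v hgJ
      have h6 := hpair b c hbc lbc v hgJ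
      by_contra! hne
      have h7 := hne a
      have h8 := hne b
      have h9 := hne c
      omega
    have hr := hreg.regular_mod_prev 1 (by simp)
    have htake : List.take 1 (monomial u (1 : K) :: monomial v (1 : K) :: tl) =
        [u].map fun u => monomial u (1 : K) := by simp
    rw [htake, ofList_monomial_smul_top, isSMulRegular_quotient_iff_mem_of_smul_mem] at hr
    -- As `v z ≥ 1`, the product of `x^v` and `x^(u - z)` is divisible by `x^u`. Regularity would
    -- force `x^u` to divide `x^(u - z)`, which is impossible since `u z ≥ 1`.
    have hmem := hr (monomial (u - Finsupp.single z 1) 1) (by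
      rw [mem_ideal_span_monomial_image]
      intro w hw
      refine ⟨u, by simp, ?_⟩
      simp only [List.getElem_cons_succ, List.getElem_cons_zero, smul_eq_mul, monomial_mul,
        mul_one] at hw
      have hw' := support_monomial_subset hw
      rw [Finset.mem_singleton] at hw'
      subst hw'
      intro j
      by_cases hj : j = z
      · subst hj
        simp
        omega
      · simp [Finsupp.single_eq_of_ne hj])
    rw [mem_ideal_span_monomial_image] at hmem
    obtain ⟨w, hw, hle⟩ := hmem (u - Finsupp.single z 1) (by
      classical
      rw [support_monomial, if_neg one_ne_zero]; simp)
    simp only [List.mem_singleton, Set.mem_ofPred_eq] at hw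
    subst hw
    have := hle z
    simp at this
    omega

end Konig

/-! ### From matroidal ideals to matroids -/

section MatroidalIdeal

variable {K : Type*} [Field K] {n : ℕ}

/-- The indicator vector of a set of variables. -/
noncomputable def indicatorVector {n : ℕ} (B : Finset (Fin n)) : Fin n →₀ ℕ :=
  Finsupp.equivFunOnFinite.symm fun i => if i ∈ B then 1 else 0

lemma indicatorVector_apply (B : Finset (Fin n)) (i : Fin n) :
    indicatorVector B i = if i ∈ B then 1 else 0 := rfl

lemma indicatorVector_le_iff (B : Finset (Fin n)) (u : Fin n →₀ ℕ) :
    indicatorVector B ≤ u ↔ B ⊆ u.support := by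
  constructor
  · intro h i hi
    have := h i
    rw [indicatorVector_apply, if_pos hi] at this
    rw [Finsupp.mem_support_iff]
    omega
  · intro h i
    rw [indicatorVector_apply]
    split_ifs with hi
    · exact Nat.one_le_iff_ne_zero.2 (Finsupp.mem_support_iff.1 (h hi))
    · exact Nat.zero_le _

lemma support_indicatorVector (B : Finset (Fin n)) : (indicatorVector B).support = B := by
  ext i
  simp [indicatorVector_apply]

lemma indicatorVector_support {u : Fin n →₀ ℕ} (hu : ∀ i, u i ≤ 1) :
    indicatorVector u.support = u := by
  ext i
  have := hu i
  rw [indicatorVector_apply]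
  split_ifs with h
  · rw [Finsupp.mem_support_iff] at h; omega
  · rw [Finsupp.notMem_support_iff] at h; omega

lemma degree_indicatorVector (B : Finset (Fin n)) :
    Finsupp.degree (indicatorVector B) = B.card := by
  rw [Finsupp.degree_eq_sum]
  simp [indicatorVector_apply]

lemma monomial_indicatorVector (B : Finset (Fin n)) :
    monomial (indicatorVector B) (1 : K) = ∏ i ∈ B, X i := by
  rw [← monomial_sum_single B fun i => i]
  have h : indicatorVector B = ∑ i ∈ B, Finsupp.single i 1 := by
    ext i
    rw [Finsupp.finsetSum_apply, indicatorVector_apply]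
    simp [Finsupp.single_apply]
  rw [h]

lemma IsMonomialIdeal.eq_span_minimalGenerators {I : Ideal (MvPolynomial (Fin n) K)}
    (hI : IsMonomialIdeal I) :
    I = Ideal.span ((fun u => monomial u (1 : K)) '' minimalGenerators I) := by
  obtain ⟨s, hs⟩ := hI
  apply le_antisymm
  · nth_rewrite 1 [hs]
    rw [Ideal.span_le]
    rintro _ ⟨u, hu, rfl⟩
    have huI : monomial u (1 : K) ∈ I := hs ▸ Ideal.subset_span ⟨u, hu, rfl⟩
    obtain ⟨v, hvu, hv⟩ := exists_minimal_le_of_wellFoundedLT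
      (fun v => monomial v (1 : K) ∈ I) u huI
    refine Ideal.mem_of_dvd _ ?_ (Ideal.subset_span ⟨v, hv, rfl⟩)
    exact monomial_dvd_monomial.2 ⟨Or.inr hvu, one_dvd _⟩
  · rw [Ideal.span_le]
    rintro _ ⟨u, hu, rfl⟩
    exact hu.1

/-- A matroidal ideal is generated by the squarefree monomials of the bases of a matroid. -/
lemma IsMatroidalIdeal.exists_matroid {I : Ideal (MvPolynomial (Fin n) K)}
    (hI : IsMatroidalIdeal I) :
    ∃ M : Matroid (Fin n),
      I = Ideal.span ((fun B : Finset (Fin n) => ∏ i ∈ B, X i) '' {B | M.IsBase B}) := by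
  classical
  obtain ⟨⟨hmon, P, hP, hbases⟩, -, hsq⟩ := hI
  -- Every vector of the finite set `P` lies below a base, so all of `P` consists of 0-1 vectors and
  -- can be read as a family of sets.
  have hP1 : ∀ v ∈ P, ∀ i, v i ≤ 1 := by
    intro v hv i
    obtain ⟨u, hvu, hu⟩ := hP.finite.exists_le_maximal hv
    have hu' : u ∈ minimalGenerators I := by rw [hbases]; exact hu
    exact (hvu i).trans (hsq u hu' i)
  have h0 : indicatorVector (∅ : Finset (Fin n)) ∈ P := by
    obtain ⟨u, hu⟩ := hP.nonempty
    exact hP.mem_of_le u hu _ (by simp [indicatorVector_le_iff])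
  have hsub : ∀ ⦃A B : Finset (Fin n)⦄, indicatorVector B ∈ P → A ⊆ B → indicatorVector A ∈ P :=
    fun A B hB hAB => hP.mem_of_le _ hB _ (by
      rwa [indicatorVector_le_iff, support_indicatorVector])
  have haug : ∀ ⦃A B : Finset (Fin n)⦄, indicatorVector A ∈ P → indicatorVector B ∈ P →
      A.card < B.card → ∃ e ∈ B, e ∉ A ∧ indicatorVector (insert e A) ∈ P := by
    intro A B hA hB hlt
    obtain ⟨i, hi, hmem⟩ := hP.augment _ hA _ hB (by simpa [degree_indicatorVector] using hlt)
    rw [indicatorVector_apply, indicatorVector_apply] at hi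
    have hiA : i ∉ A := by intro h; rw [if_pos h] at hi; split_ifs at hi <;> omega
    have hiB : i ∈ B := by by_contra h; rw [if_neg h] at hi; omega
    refine ⟨i, hiB, hiA, ?_⟩
    convert hmem using 1
    ext j
    rw [Finsupp.add_apply, indicatorVector_apply, indicatorVector_apply, Finsupp.single_apply]
    by_cases hj : i = j
    · subst hj; simp [hiA]
    · simp [hj, Ne.symm hj]
  let N : IndepMatroid (Fin n) := IndepMatroid.ofFinset Set.univ (fun A => indicatorVector A ∈ P)
    h0 hsub haug fun _ _ => Set.subset_univ _
  have hindep : ∀ A : Finset (Fin n), N.matroid.Indep A ↔ indicatorVector A ∈ P := fun A =>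
    IndepMatroid.ofFinset_indep Set.univ (fun A => indicatorVector A ∈ P) h0 hsub haug
      fun _ _ => Set.subset_univ _
  refine ⟨N.matroid, ?_⟩
  have himage : minimalGenerators I = indicatorVector '' {B | N.matroid.IsBase B} := by
    rw [hbases]
    ext u
    constructor
    · intro hu
      have hu1 := indicatorVector_support (hP1 u hu.1)
      refine ⟨u.support, ?_, hu1⟩
      refine Matroid.isBase_iff_maximal_indep.2 ⟨(hindep _).2 (hu1.symm ▸ hu.1), fun A hA hle => ?_⟩
      lift A to Finset (Fin n) using A.toFinite
      have := hu.2 ((hindep A).1 hA) (by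
        rw [← hu1, indicatorVector_le_iff, support_indicatorVector]; exact_mod_cast hle)
      rw [indicatorVector_le_iff] at this
      exact_mod_cast this
    · rintro ⟨B, hB, rfl⟩
      refine ⟨(hindep B).1 hB.indep, fun v hv hle => ?_⟩
      rw [indicatorVector_le_iff] at hle
      have hv1 := indicatorVector_support (hP1 v hv)
      have : (B : Set (Fin n)) = v.support :=
        hB.eq_of_subset_indep ((hindep _).2 (hv1.symm ▸ hv)) (by exact_mod_cast hle)
      rw [← hv1, Finset.coe_injective this]
  rw [hmon.eq_span_minimalGenerators, himage, Set.image_image]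
  simp_rw [monomial_indicatorVector]

/-- An ideal generated by squarefree monomials is radical. -/
lemma mem_of_mul_self_mem_span_prod_X (S : Set (Finset (Fin n))) {f : MvPolynomial (Fin n) K}
    (hf : f * f ∈ Ideal.span ((fun B : Finset (Fin n) => ∏ i ∈ B, X i) '' S)) :
    f ∈ Ideal.span ((fun B : Finset (Fin n) => (∏ i ∈ B, X i : MvPolynomial (Fin n) K)) '' S) := by
  by_contra hf'
  have him : (fun B : Finset (Fin n) => (∏ i ∈ B, X i : MvPolynomial (Fin n) K)) '' S =
      (fun u => monomial u 1) '' (indicatorVector '' S) := by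
    rw [Set.image_image]
    simp_rw [monomial_indicatorVector]
  have h1 := hf'
  rw [him, mem_ideal_span_monomial_image] at h1
  push Not at h1
  obtain ⟨u, hu, h1⟩ := h1
  -- No generator divides `x^u`, so each has a variable outside the support of `u`. The prime on
  -- those variables contains the ideal but no polynomial with the term `x^u`.
  have hle : Ideal.span ((fun B : Finset (Fin n) => (∏ i ∈ B, X i : MvPolynomial (Fin n) K)) '' S) ≤
      monomialPrime K u.supportᶜ := by
    rw [Ideal.span_le]
    rintro _ ⟨B, hB, rfl⟩
    have h2 := h1 _ ⟨B, hB, rfl⟩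
    rw [indicatorVector_le_iff, Finset.not_subset] at h2
    obtain ⟨i, hi, hiu⟩ := h2
    exact Ideal.mem_of_dvd _ (Finset.dvd_prod_of_mem _ hi)
      (X_mem_monomialPrime (Finset.mem_compl.2 hiu))
  have hfu : f ∈ monomialPrime K u.supportᶜ :=
    or_self_iff.1 ((monomialPrime_isPrime _).mem_or_mem (hle hf))
  rw [← pow_one (monomialPrime K _), mem_monomialPrime_pow_iff] at hfu
  have h3 := hfu u hu
  rw [Finset.sum_eq_zero fun i hi => Finsupp.notMem_support_iff.1 (Finset.mem_compl.1 hi)] at h3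
  omega

/-- If every nonloop of `M` is parallel to an element of the base `B`, then the ideal of `M` is a
product of primes generated by disjoint sets of variables. -/
lemma exists_eq_prod_monomialPrime {M : Matroid (Fin n)} {B : Set (Fin n)} (hB : M.IsBase B)
    (h : ∀ c, M.IsNonloop c → ∃ b ∈ B, c ∈ M.closure {b}) :
    ∃ (t : ℕ) (F : Fin t → Finset (Fin n)),
      (∀ i, (F i).Nonempty) ∧ (∀ i j, i ≠ j → Disjoint (F i) (F j)) ∧
        Ideal.span ((fun B : Finset (Fin n) => ∏ i ∈ B, X i) '' {B | M.IsBase B}) =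
          ∏ i, monomialPrime K (F i) := by
  classical
  lift B to Finset (Fin n) using B.toFinite
  let G : Fin n → Finset (Fin n) := fun b => (parallelClass M b).toFinite.toFinset
  have hG : ∀ b c, c ∈ G b ↔ c ∈ parallelClass M b := fun b c => by simp [G]
  let e := B.equivFin.symm
  refine ⟨B.card, fun i => G (e i).1, fun i => ?_, fun i j hij => ?_, ?_⟩
  · have := hB.indep.isNonloop_of_mem (e i).2
    exact ⟨(e i).1, (hG _ _).2 ⟨this, M.mem_closure_self _ this.mem_ground⟩⟩
  · rw [Finset.disjoint_left]
    intro c hc hc'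
    exact hij (e.injective (Subtype.ext (eq_of_mem_parallelClass hB.indep (e i).2 (e j).2
      ((hG _ _).1 hc) ((hG _ _).1 hc'))))
  rw [Equiv.prod_comp e fun b : B => monomialPrime K (G b.1),
    Finset.prod_coe_sort B fun b => monomialPrime K (G b)]
  apply le_antisymm
  · rw [Ideal.span_le]
    rintro _ ⟨B', hB', rfl⟩
    obtain ⟨t, ht, htc⟩ := exists_bijOn_parallelClass hB hB' h
    have : ∏ c ∈ B', monomialPrime K (G (t c)) = ∏ b ∈ B, monomialPrime K (G b) :=
      Finset.prod_nbij t ht.mapsTo ht.injOn ht.surjOn fun _ _ => rfl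
    rw [← this]
    exact Ideal.prod_mem_prod fun c hc => X_mem_monomialPrime ((hG _ _).2 (htc c hc))
  · simp_rw [monomialPrime]
    rw [Ideal.prod_span, Ideal.span_le]
    intro f hf
    obtain ⟨g, hg, rfl⟩ := (Set.mem_finsetProd _ _ _).1 hf
    have hd : ∀ b, ∃ d, b ∈ B → d ∈ G b ∧ X d = g b := by
      intro b
      by_cases hb : b ∈ B
      · obtain ⟨d, hd, hdg⟩ := hg hb
        exact ⟨d, fun _ => ⟨hd, hdg⟩⟩
      · exact ⟨b, fun h => (hb h).elim⟩
    choose d hd using hd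
    have hinj : Set.InjOn d B := by
      intro b hb b' hb' hbb
      exact eq_of_mem_parallelClass hB.indep hb hb' ((hG _ _).1 (hd b hb).1)
        (hbb ▸ (hG _ _).1 (hd b' hb').1)
    -- One variable from each parallel class: the chosen variables form a transversal, hence a base.
    refine Ideal.subset_span ⟨B.image d, ?_, ?_⟩
    · have := isBase_image_of_mem_parallelClass hB fun b hb => (hG _ _).1 (hd b hb).1
      simpa using this
    · simp only
      rw [Finset.prod_image hinj]
      exact Finset.prod_congr rfl fun b hb => (hd b hb).2

end MatroidalIdeal

/-! ### Associated primes and symbolic powers -/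

section Equivalence

variable {K : Type*} [Field K] {n : ℕ}

lemma isAssociatedPrime_quotient_iff {R : Type*} [CommRing R] [IsNoetherianRing R] {I P : Ideal R} :
    IsAssociatedPrime P (R ⧸ I) ↔ P.IsPrime ∧ ∃ f, ∀ g, g ∈ P ↔ g * f ∈ I := by
  rw [isAssociatedPrime_iff]
  refine and_congr_right fun _ => ⟨?_, ?_⟩
  · rintro ⟨x, rfl⟩
    obtain ⟨f, rfl⟩ := Ideal.Quotient.mk_surjective x
    refine ⟨f, fun g => ?_⟩
    rw [Submodule.mem_colon_singleton, Submodule.mem_bot, ← Ideal.Quotient.eq_zero_iff_mem,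
      map_mul]
    rfl
  · rintro ⟨f, hf⟩
    refine ⟨Ideal.Quotient.mk I f, Ideal.ext fun g => ?_⟩
    rw [hf, Submodule.mem_colon_singleton, Submodule.mem_bot, ← Ideal.Quotient.eq_zero_iff_mem,
      map_mul]
    rfl

lemma mem_symbolicPower_iff {R : Type*} [CommRing R] {I : Ideal R} {k : ℕ} {g : R} :
    g ∈ symbolicPower I k ↔
      ∀ P : Ideal R, IsAssociatedPrime P (R ⧸ I) → ∃ s ∉ P, s * g ∈ I ^ k := by
  rw [symbolicPower, Ideal.mem_iInf, Subtype.forall]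
  refine forall₂_congr fun P hP => ?_
  have : P.IsPrime := hP.isPrime
  rw [Ideal.mem_comap, IsLocalization.algebraMap_mem_map_algebraMap_iff P.primeCompl]
  rfl

lemma pow_le_symbolicPower {R : Type*} [CommRing R] (I : Ideal R) (k : ℕ) :
    I ^ k ≤ symbolicPower I k := fun g hg => mem_symbolicPower_iff.2 fun _ hP =>
  ⟨1, (Ideal.ne_top_iff_one _).1 hP.isPrime.ne_top, by simpa using hg⟩

/-! ### Products of primes on disjoint blocks satisfy (b) and (c) -/

section Product

variable {t : ℕ} {F : Fin t → Finset (Fin n)}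

lemma isAssociatedPrime_monomialPrime (hne : ∀ i, (F i).Nonempty)
    (hF : ∀ i j, i ≠ j → Disjoint (F i) (F j)) (i : Fin t) :
    IsAssociatedPrime (monomialPrime K (F i))
      (MvPolynomial (Fin n) K ⧸ ∏ i, monomialPrime K (F i)) := by
  refine isAssociatedPrime_quotient_iff.2 ⟨monomialPrime_isPrime _, ?_⟩
  choose c hc using hne
  -- One variable from each other block; by disjointness this monomial avoids `P_{F i}`.
  refine ⟨∏ j ∈ Finset.univ.erase i, X (c j), fun g => ⟨fun hg => ?_, fun hg => ?_⟩⟩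
  · rw [← Finset.mul_prod_erase Finset.univ _ (Finset.mem_univ i)]
    exact Ideal.mul_mem_mul hg (Ideal.prod_mem_prod fun j _ => X_mem_monomialPrime (hc j))
  · have h1 : ∏ i, monomialPrime K (F i) ≤ monomialPrime K (F i) :=
      Ideal.prod_le_inf.trans (Finset.inf_le (Finset.mem_univ i))
    refine ((monomialPrime_isPrime _).mem_or_mem (h1 hg)).resolve_right fun h2 => ?_
    obtain ⟨j, hj, hjm⟩ := (monomialPrime_isPrime (K := K) (F i)).prod_mem_iff.1 h2
    rw [X_mem_monomialPrime_iff] at hjm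
    exact Finset.disjoint_left.1 (hF j i (Finset.ne_of_mem_erase hj)) (hc j) hjm

lemma symbolicPower_prod_monomialPrime (hne : ∀ i, (F i).Nonempty)
    (hF : ∀ i j, i ≠ j → Disjoint (F i) (F j)) (k : ℕ) :
    symbolicPower (∏ i, monomialPrime K (F i)) k = (∏ i, monomialPrime K (F i)) ^ k := by
  refine le_antisymm (fun g hg => ?_) (pow_le_symbolicPower _ _)
  rw [← Finset.prod_pow]
  refine mem_prod_monomialPrime_pow _ F (fun i _ j _ h => hF i j h) g k fun u hu i _ => ?_
  obtain ⟨s, hs, hsg⟩ := mem_symbolicPower_iff.1 hg _ (isAssociatedPrime_monomialPrime hne hF i)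
  have h1 : ∏ i, monomialPrime K (F i) ≤ monomialPrime K (F i) :=
    Ideal.prod_le_inf.trans (Finset.inf_le (Finset.mem_univ i))
  exact mem_monomialPrime_pow_iff.1
    (mem_monomialPrime_pow_of_mul_mem hs (Ideal.pow_right_mono h1 k hsg)) u hu

lemma substZeroOne_monomialPrime {A B : Finset (Fin n)} (hAB : Disjoint A B)
    (G : Finset (Fin n)) : substZeroOne (monomialPrime K G) A B =
      if Disjoint G B then monomialPrime K (G \ A) else ⊤ := by
  rw [substZeroOne, monomialPrime, Ideal.map_span]
  split_ifs with h
  · apply le_antisymm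
    · rw [Ideal.span_le]
      rintro _ ⟨_, ⟨i, hi, rfl⟩, rfl⟩
      rw [aeval_X, if_neg (Finset.disjoint_left.1 h hi)]
      split_ifs with hA
      · exact Ideal.zero_mem _
      · exact X_mem_monomialPrime (Finset.mem_sdiff.2 ⟨hi, hA⟩)
    · rw [monomialPrime, Ideal.span_le]
      rintro _ ⟨i, hi, rfl⟩
      obtain ⟨hiG, hiA⟩ := Finset.mem_sdiff.1 hi
      refine Ideal.subset_span ⟨X i, ⟨i, hiG, rfl⟩, ?_⟩
      rw [aeval_X, if_neg hiA, if_neg (Finset.disjoint_left.1 h hiG)]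
  · rw [Finset.not_disjoint_iff] at h
    obtain ⟨i, hiG, hiB⟩ := h
    rw [Ideal.eq_top_iff_one]
    refine Ideal.subset_span ⟨X i, ⟨i, hiG, rfl⟩, ?_⟩
    rw [aeval_X, if_neg (Finset.disjoint_right.1 hAB hiB), if_pos hiB]

/-- The substitution acts factor by factor: blocks meeting `B` become the unit ideal and drop out,
the others lose their variables in `A`. A block may become empty, giving the zero ideal, which the
König lemma allows. -/
lemma isPacked_prod_monomialPrime (hF : ∀ i j, i ≠ j → Disjoint (F i) (F j)) :
    IsPacked (∏ i, monomialPrime K (F i)) := by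
  intro A B hAB
  have h1 : substZeroOne (∏ i, monomialPrime K (F i)) A B =
      ∏ i : {i // Disjoint (F i) B}, monomialPrime K (F i \ A) := by
    have h2 : substZeroOne (∏ i, monomialPrime K (F i)) A B =
        ∏ i, substZeroOne (monomialPrime K (F i)) A B := map_prod (Ideal.mapHom _) _ _
    rw [h2]
    simp_rw [substZeroOne_monomialPrime hAB, ← Ideal.one_eq_top]
    rw [← Finset.prod_filter]
    exact Finset.prod_subtype _ (by simp) _
  rw [h1]
  exact isKonig_prod_monomialPrime (fun i : {i // Disjoint (F i) B} => F i \ A) fun i j hij =>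
    (hF _ _ fun h => hij (Subtype.ext h)).mono Finset.sdiff_subset Finset.sdiff_subset

end Product

/-! ### A triangle of bases violates (b) and (c) -/

section Triangle

variable {M : Matroid (Fin n)} {W : Finset (Fin n)} {x y c : Fin n}

/-- The ideal generated by the squarefree monomials of the bases of `M`. -/
noncomputable def basisIdeal (K : Type*) [Field K] {n : ℕ} (M : Matroid (Fin n)) :
    Ideal (MvPolynomial (Fin n) K) :=
  Ideal.span ((fun B : Finset (Fin n) => ∏ i ∈ B, X i) '' {B | M.IsBase B})

lemma prod_X_mem_basisIdeal {B : Finset (Fin n)} (hB : M.IsBase B) :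
    ∏ i ∈ B, X i ∈ basisIdeal K M :=
  Ideal.subset_span ⟨B, hB, rfl⟩

/-- Serves as a degree bound: the `r`-th power of the ideal of all variables has no terms of degree
below `r`. -/
lemma basisIdeal_le_pow {r : ℕ} (h : ∀ B : Finset (Fin n), M.IsBase B → B.card = r) :
    basisIdeal K M ≤ monomialPrime K Finset.univ ^ r := by
  rw [basisIdeal, Ideal.span_le]
  rintro _ ⟨B, hB, rfl⟩
  rw [← h B hB, ← Finset.prod_const]
  exact Ideal.prod_mem_prod fun i _ => X_mem_monomialPrime (Finset.mem_univ i)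

/-- Three bases in a set of one more element. -/
structure IsTriangle (M : Matroid (Fin n)) (W : Finset (Fin n)) (x y c : Fin n) : Prop where
  xy : x ≠ y
  xc : x ≠ c
  yc : y ≠ c
  x_notMem : x ∉ W
  y_notMem : y ∉ W
  c_notMem : c ∉ W
  base_xy : M.IsBase (insert x (insert y W) : Finset (Fin n))
  base_xc : M.IsBase (insert x (insert c W) : Finset (Fin n))
  base_yc : M.IsBase (insert y (insert c W) : Finset (Fin n))

lemma IsTriangle.card_eq (h : IsTriangle M W x y c) {B : Finset (Fin n)} (hB : M.IsBase B) :
    B.card = W.card + 2 := by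
  have := hB.ncard_eq_ncard_of_isBase h.base_xy
  rw [Set.ncard_coe_finset, Set.ncard_coe_finset, Finset.card_insert_of_notMem,
    Finset.card_insert_of_notMem h.y_notMem] at this
  · exact this
  · simp [h.xy, h.x_notMem]

/-- With `W = B \ {x, y}`, the base `B` and its two exchanges are `W` together with two of `x`, `y`,
`c`. -/
lemma exists_isTriangle {B : Set (Fin n)} (hB : M.IsBase B)
    (h : ∃ c ∉ B, ∃ x ∈ B, ∃ y ∈ B, x ≠ y ∧ M.IsBase (insert c (B \ {x})) ∧
      M.IsBase (insert c (B \ {y}))) : ∃ W x y c, IsTriangle M W x y c := by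
  classical
  lift B to Finset (Fin n) using B.toFinite
  obtain ⟨c, hc, x, hx, y, hy, hxy, h1, h2⟩ := h
  rw [Finset.mem_coe] at hc hx hy
  refine ⟨(B.erase x).erase y, x, y, c, hxy, ?_, ?_, ?_, ?_, ?_, ?_, ?_, ?_⟩
  · rintro rfl; exact hc hx
  · rintro rfl; exact hc hy
  · simp
  · simp
  · simp [hc]
  · rw [Finset.insert_erase (by simp [hy, hxy.symm]), Finset.insert_erase hx]; exact hB
  · rw [Finset.insert_comm, Finset.erase_right_comm, Finset.insert_erase (by simp [hx, hxy])]
    simpa using h2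
  · rw [Finset.insert_comm, Finset.insert_erase (by simp [hy, hxy.symm])]
    simpa using h1

/-- The second symbolic power of the ideal of a matroid with a triangle differs from its square. -/
lemma IsTriangle.symbolicPower_ne (h : IsTriangle M W x y c) :
    symbolicPower (basisIdeal K M) 2 ≠ basisIdeal K M ^ 2 := by
  intro heq
  let p : MvPolynomial (Fin n) K := X x * X y * X c * (∏ i ∈ W, X i) ^ 2
  have hp : p ∈ symbolicPower (basisIdeal K M) 2 := by
    refine mem_symbolicPower_iff.2 fun P hP => ?_
    obtain ⟨hPp, f, hf⟩ := isAssociatedPrime_quotient_iff.1 hP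
    -- Here `P = (I : f)`. If `f ∈ P`, then `f² ∈ I`, so `f ∈ I` because `I` is radical, and `1 ∈
    -- P`.
    have hfP : f ∉ P := fun hfP => hPp.ne_top ((Ideal.eq_top_iff_one _).2 ((hf 1).2 (by
      rw [one_mul]; exact mem_of_mul_self_mem_span_prod_X _ ((hf f).1 hfP))))
    refine ⟨f * f, fun h => hfP (or_self_iff.1 (hPp.mem_or_mem h)), ?_⟩
    -- Since `f` multiplies `P` into `I`, two factors of `p` in `P` suffice. They are either both
    -- copies of `∏ W`, or two of `x`, `y`, `c`, because `P` must meet each pair.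
    have key : ∀ a b q, a ∈ P → b ∈ P → p = a * b * q → f * f * p ∈ basisIdeal K M ^ 2 := by
      intro a b q ha hb hq
      have h1 : f * f * p = (a * f) * (b * f) * q := by rw [hq]; ring
      rw [h1, sq]
      exact Ideal.mul_mem_right _ _ (Ideal.mul_mem_mul ((hf a).1 ha) ((hf b).1 hb))
    by_cases hW : ∏ i ∈ W, X i ∈ P
    · exact key _ _ (X x * X y * X c) hW hW (by ring)
    have hle : basisIdeal K M ≤ P := fun g hg => (hf g).2 (Ideal.mul_mem_right _ _ hg)
    have hpair : ∀ a b : Fin n, a ≠ b → a ∉ W → b ∉ W →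
        M.IsBase (insert a (insert b W) : Finset (Fin n)) →
        (X a ∈ P ∨ X b ∈ P) := by
      intro a b hab ha hb hbase
      have h1 := hle (prod_X_mem_basisIdeal hbase)
      rw [Finset.prod_insert (by simp [hab, ha]), Finset.prod_insert hb] at h1
      rcases hPp.mem_or_mem h1 with h2 | h2
      · exact Or.inl h2
      · exact Or.inr ((hPp.mem_or_mem h2).resolve_right hW)
    have hxy : X x ∈ P → X y ∈ P → f * f * p ∈ basisIdeal K M ^ 2 := fun h1 h2 =>
      key _ _ (X c * (∏ i ∈ W, X i) ^ 2) h1 h2 (by ring)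
    have hxc : X x ∈ P → X c ∈ P → f * f * p ∈ basisIdeal K M ^ 2 := fun h1 h2 =>
      key _ _ (X y * (∏ i ∈ W, X i) ^ 2) h1 h2 (by ring)
    have hyc : X y ∈ P → X c ∈ P → f * f * p ∈ basisIdeal K M ^ 2 := fun h1 h2 =>
      key _ _ (X x * (∏ i ∈ W, X i) ^ 2) h1 h2 (by ring)
    have h1 := hpair x y h.xy h.x_notMem h.y_notMem h.base_xy
    have h2 := hpair x c h.xc h.x_notMem h.c_notMem h.base_xc
    have h3 := hpair y c h.yc h.y_notMem h.c_notMem h.base_yc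
    rcases h1 with h1 | h1
    · rcases h3 with h3 | h3
      · exact hxy h1 h3
      · exact hxc h1 h3
    · rcases h2 with h2 | h2
      · exact hxy h2 h1
      · exact hyc h1 h2
  rw [heq] at hp
  -- Elements of `I²` have no terms of degree below `2(|W| + 2)`, while `p` has degree `2|W| + 3`.
  have hp2 := Ideal.pow_right_mono (basisIdeal_le_pow (K := K) fun B hB => h.card_eq hB) 2 hp
  have hpm : p = monomial (Finsupp.single x 1 + Finsupp.single y 1 + Finsupp.single c 1 +
      2 • indicatorVector W) 1 := by
    simp only [p]
    rw [← monomial_indicatorVector, monomial_pow]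
    simp only [X, monomial_mul, one_pow, mul_one]
  rw [← pow_mul, hpm, monomial_mem_monomialPrime_pow_iff, ← Finsupp.degree_eq_sum] at hp2
  simp only [map_add, map_nsmul, degree_indicatorVector, Finsupp.degree_single] at hp2
  simp at hp2
  omega

/-- A base has `|W| + 2` elements and so does not fit into `W ∪ {r}`. It contains an element of `A`,
which is sent to 0, or one of `p`, `q`. -/
lemma substZeroOne_basisIdeal_le {A W : Finset (Fin n)} {p q r : Fin n}
    (hp : p ∉ W) (hq : q ∉ W) (hA : ∀ z, z ∉ A → z = p ∨ z = q ∨ z = r ∨ z ∈ W)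
    (hcard : ∀ B : Finset (Fin n), M.IsBase B → B.card = W.card + 2) :
    substZeroOne (basisIdeal K M) A W ≤ monomialPrime K {p, q} := by
  rw [substZeroOne, Ideal.map_le_iff_le_comap, basisIdeal, Ideal.span_le]
  rintro _ ⟨B, hB, rfl⟩
  rw [SetLike.mem_coe, Ideal.mem_comap, map_prod]
  obtain ⟨z, hzB, hz⟩ : ∃ z ∈ B, z ∈ A ∨ z = p ∨ z = q := by
    by_contra! hne
    have hsub : B ⊆ insert r W := by
      intro z hz
      obtain ⟨h1, h2, h3⟩ := hne z hz
      rcases hA z h1 with h | h | h | h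
      · exact (h2 h).elim
      · exact (h3 h).elim
      · simp [h]
      · simp [h]
    have h1 := Finset.card_le_card hsub
    have h2 := Finset.card_insert_le r W
    have h3 := hcard B hB
    omega
  refine Ideal.mem_of_dvd _ (Finset.dvd_prod_of_mem _ hzB) ?_
  rw [aeval_X]
  by_cases hzA : z ∈ A
  · rw [if_pos hzA]; exact Ideal.zero_mem _
  · have hz' := hz.resolve_left hzA
    have hzW : z ∉ W := by rcases hz' with rfl | rfl <;> assumption
    rw [if_neg hzA, if_neg hzW]
    exact X_mem_monomialPrime (by simpa using hz')

/-- The ideal of a matroid with a triangle is not packed. -/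
lemma IsTriangle.not_isPacked (h : IsTriangle M W x y c) : ¬ IsPacked (basisIdeal K M) := by
  intro hpk
  -- Deleting `A` and contracting `W` leaves the uniform matroid of rank 2 on `x`, `y`, `c`.
  let A : Finset (Fin n) := (insert x (insert y (insert c W)))ᶜ
  have hA : ∀ z, z ∉ A ↔ z = x ∨ z = y ∨ z = c ∨ z ∈ W := fun z => by
    simp only [A, Finset.mem_compl, not_not, Finset.mem_insert]
  have hAW : Disjoint A W := Finset.disjoint_right.2 fun z hz => (hA z).2 (by simp [hz])
  have hmem : ∀ a b : Fin n, a ≠ b → a ∉ W → b ∉ W → a ∉ A → b ∉ A →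
      M.IsBase (insert a (insert b W) : Finset (Fin n)) →
      X a * X b ∈ substZeroOne (basisIdeal K M) A W := by
    intro a b hab ha hb haA hbA hbase
    have h1 := Ideal.mem_map_of_mem (aeval (R := K) fun i : Fin n =>
      if i ∈ A then (0 : MvPolynomial (Fin n) K) else if i ∈ W then 1 else X i)
      (prod_X_mem_basisIdeal hbase)
    rw [map_prod, Finset.prod_insert (by simp [hab, ha]), Finset.prod_insert hb, aeval_X, aeval_X,
      if_neg haA, if_neg hbA, if_neg ha, if_neg hb, Finset.prod_eq_one, mul_one] at h1
    · exact h1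
    · intro z hz
      rw [aeval_X, if_neg (Finset.disjoint_right.1 hAW hz), if_pos hz]
  have hxA : x ∉ A := (hA x).2 (by simp)
  have hyA : y ∉ A := (hA y).2 (by simp)
  have hcA : c ∉ A := (hA c).2 (by simp)
  have hcard : ∀ B : Finset (Fin n), M.IsBase B → B.card = W.card + 2 := fun B hB => h.card_eq hB
  refine not_isKonig_of_triangle h.xy h.xc h.yc
    (hmem x y h.xy h.x_notMem h.y_notMem hxA hyA h.base_xy)
    (hmem x c h.xc h.x_notMem h.c_notMem hxA hcA h.base_xc)
    (hmem y c h.yc h.y_notMem h.c_notMem hyA hcA h.base_yc)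
    (substZeroOne_basisIdeal_le (r := c) h.x_notMem h.y_notMem (fun z hz => ?_) hcard)
    (substZeroOne_basisIdeal_le (r := y) h.x_notMem h.c_notMem (fun z hz => ?_) hcard)
    (substZeroOne_basisIdeal_le (r := x) h.y_notMem h.c_notMem (fun z hz => ?_) hcard)
    (hpk A W hAW)
  all_goals
    have := (hA z).1 hz
    tauto

end Triangle

end Equivalence

theorem theorem5p5 {K : Type*} [Field K] {n : ℕ} (I : Ideal (MvPolynomial (Fin n) K))
    (hI : IsMatroidalIdeal I) :
    List.TFAE [
      ∃ (t : ℕ) (F : Fin t → Finset (Fin n)),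
        (∀ i, (F i).Nonempty) ∧ (∀ i j, i ≠ j → Disjoint (F i) (F j)) ∧
          I = ∏ i, monomialPrime K (F i),
      ∀ k : ℕ, 1 ≤ k → symbolicPower I k = I ^ k,
      IsPacked I] := by
  obtain ⟨M, rfl⟩ := hI.exists_matroid
  obtain ⟨B, hB⟩ := M.exists_isBase
  tfae_have 1 → 2 := by
    rintro ⟨t, F, hne, hF, h⟩ k -
    rw [h]
    exact symbolicPower_prod_monomialPrime hne hF k
  tfae_have 1 → 3 := by
    rintro ⟨t, F, -, hF, h⟩
    rw [h]
    exact isPacked_prod_monomialPrime hF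
  tfae_have 2 → 1 := by
    intro h
    rcases parallel_or_exists_exchange hB with h1 | h1
    · exact exists_eq_prod_monomialPrime hB h1
    · obtain ⟨W, x, y, c, htri⟩ := exists_isTriangle hB h1
      exact (htri.symbolicPower_ne (h 2 one_le_two)).elim
  tfae_have 3 → 1 := by
    intro h
    rcases parallel_or_exists_exchange hB with h1 | h1
    · exact exists_eq_prod_monomialPrime hB h1
    · obtain ⟨W, x, y, c, htri⟩ := exists_isTriangle hB h1
      exact (htri.not_isPacked h).elim
  tfae_finish
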